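/- Let $K$ be an algebraically closed field of characteristic zero and let $L=K\{\{t\}\}=\bigcup_{N\ge 1}K((t^{1/N}))$ be the field of formal Puiseux series over $K$, with valuation $\operatorname{val}:L\to\mathbb{Q}\cup\{\infty\}$, where $\operatorname{val}(a)$ is the least exponent of $t$ occurring in $a\neq 0$ and $\operatorname{val}(0)=\infty$. For $\omega\in\mathbb{R}^n$ and $0\ne f\in L[x_1,\dots,x_n]$, the $t$-initial form $\operatorname{tin}_\omega(f)\in K[x_1,\dots,x_n]$ is the sum of all those terms $a\,t^\alpha x^\beta$ ($0\neq a\in K$) of $f$ for which $-\alpha+\omega\cdot\beta$ is maximal, with $t$ replaced by $1$; put $\operatorname{tin}_\omega(0)=0$. For an ideal $J$ of $L[x_1,\dots,x_n]$ let $\operatorname{tin}_\omega(J)=\langle \operatorname{tin}_\omega(f)\mid f\in J\rangle\subseteq K[x_1,\dots,x_n]$, and let $\operatorname{Trop}(J)$ be the set of all $\omega\in\mathbb{R}^n$ such that $\operatorname{tin}_\omega(J)$ contains no monomial (the constant $1$ being a monomial). **Theorem 3.1 (Lifting Lemma).** If $J\subset L[x_1,\dots,x_n]$ is a zero-dimensional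 ideal (that is, $L[x_1,\dots,x_n]/J$ has Krull dimension $0$) and $\omega\in\operatorname{Trop}(J)\cap\mathbb{Q}^n$, then there is a point $p=(p_1,\dots,p_n)\in L^n$ at which all polynomials in $J$ vanish and such that $-\operatorname{val}(p_i)=\omega_i$ for $i=1,\dots,n$. -/

import Mathlib

noncomputable section

namespace TropicalLifting

/-- The additive map `ℤ → ℚ`, `m ↦ m / N`. -/
def expMap (N : ℕ+) : ℤ →+ ℚ where
  toFun m := (m : ℚ) / ((N : ℕ) : ℚ)
  map_zero' := by simp
  map_add' a b := by push_cast; ring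

lemma expMap_le_iff (N : ℕ+) (a b : ℤ) : expMap N a ≤ expMap N b ↔ a ≤ b := by
  have hN : (0 : ℚ) < ((N : ℕ) : ℚ) := by exact_mod_cast N.pos
  change (a : ℚ) / ((N : ℕ) : ℚ) ≤ (b : ℚ) / ((N : ℕ) : ℚ) ↔ a ≤ b
  rw [div_le_div_iff_of_pos_right hN]
  exact Int.cast_le

lemma expMap_injective (N : ℕ+) : Function.Injective (expMap N) := fun a b h =>
  le_antisymm ((expMap_le_iff N a b).1 h.le) ((expMap_le_iff N b a).1 h.ge)

/-- The embedding of the field of formal Laurent series over `K` into the field of Hahn series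
with exponents in `ℚ` that sends the variable to `t ^ (1 / N)`. -/
def laurentEmb (K : Type*) [Field K] (N : ℕ+) : LaurentSeries K →+* HahnSeries ℚ K :=
  HahnSeries.embDomainRingHom (expMap N) (expMap_injective N) (expMap_le_iff N)

/-- The field `L_N = K((t^(1/N)))`, the quotient field of `R_N = K[[t^(1/N)]]`, as a subfield of
the field of Hahn series with exponents in `ℚ`. -/
def laurentSubfield (K : Type*) [Field K] (N : ℕ+) : Subfield (HahnSeries ℚ K) :=
  (laurentEmb K N).fieldRange

lemma mem_laurentSubfield_iff {K : Type*} [Field K] {N : ℕ+} {x : HahnSeries ℚ K} :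
    x ∈ laurentSubfield K N ↔ ∀ q ∈ x.support, ∃ m : ℤ, q = (m : ℚ) / ((N : ℕ) : ℚ) := by
  constructor
  · rintro ⟨y, rfl⟩ q hq
    obtain ⟨m, -, rfl⟩ := HahnSeries.support_embDomain_subset hq
    exact ⟨m, rfl⟩
  · intro h
    have hfin : (Function.support fun m : ℤ => x.coeff (expMap N m)).IsPWO := by
      have hx := x.isPWO_support
      intro u
      obtain ⟨a, b, hab, hle⟩ := hx (fun k => ⟨expMap N (u k).1, (u k).2⟩)
      exact ⟨a, b, hab, (expMap_le_iff N _ _).1 hle⟩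
    refine ⟨⟨fun m => x.coeff (expMap N m), hfin⟩, ?_⟩
    ext q
    by_cases hq : q ∈ x.support
    · obtain ⟨m, rfl⟩ := h q hq
      exact HahnSeries.embDomain_coeff (f := ⟨⟨expMap N, expMap_injective N⟩, expMap_le_iff N _ _⟩)
    · have h0 : x.coeff q = 0 := by simpa using hq
      rw [h0]
      by_cases hr : q ∈ Set.range (expMap N)
      · obtain ⟨m, rfl⟩ := hr
        exact (HahnSeries.embDomain_coeff
          (f := ⟨⟨expMap N, expMap_injective N⟩, expMap_le_iff N _ _⟩)).trans h0
      · exact HahnSeries.embDomain_of_notMem_range hr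

lemma laurentSubfield_mono (K : Type*) [Field K] {N M : ℕ+} (h : N ∣ M) :
    laurentSubfield K N ≤ laurentSubfield K M := by
  obtain ⟨c, rfl⟩ := h
  intro x hx
  rw [mem_laurentSubfield_iff] at hx ⊢
  intro q hq
  obtain ⟨m, rfl⟩ := hx q hq
  have hc : (((c : ℕ+) : ℕ) : ℚ) ≠ 0 := by exact_mod_cast c.ne_zero
  refine ⟨m * (c : ℕ), ?_⟩
  push_cast
  rw [mul_div_mul_right _ _ hc]

/-- The field `K{{t}} = ⋃_N K((t^(1/N)))` of formal Puiseux series over `K`, as a subfield of the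
field of Hahn series with exponents in `ℚ`. -/
def puiseuxSubfield (K : Type*) [Field K] : Subfield (HahnSeries ℚ K) where
  carrier := {x | ∃ N : ℕ+, x ∈ laurentSubfield K N}
  zero_mem' := ⟨1, zero_mem _⟩
  one_mem' := ⟨1, one_mem _⟩
  add_mem' := by
    rintro x y ⟨N, hx⟩ ⟨M, hy⟩
    exact ⟨N * M, add_mem (laurentSubfield_mono K (Dvd.intro _ rfl) hx)
      (laurentSubfield_mono K (Dvd.intro_left _ rfl) hy)⟩
  mul_mem' := by
    rintro x y ⟨N, hx⟩ ⟨M, hy⟩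
    exact ⟨N * M, mul_mem (laurentSubfield_mono K (Dvd.intro _ rfl) hx)
      (laurentSubfield_mono K (Dvd.intro_left _ rfl) hy)⟩
  neg_mem' := by
    rintro x ⟨N, hx⟩
    exact ⟨N, neg_mem hx⟩
  inv_mem' := by
    rintro x ⟨N, hx⟩
    exact ⟨N, inv_mem hx⟩

/-- The type of formal Puiseux series over `K`. -/
abbrev PuiseuxSeries (K : Type*) [Field K] : Type _ := puiseuxSubfield K

/-- The valuation of a Puiseux series: the least exponent that occurs in it, and `⊤` for `0`. -/
def val {K : Type*} [Field K] (x : PuiseuxSeries K) : WithTop ℚ :=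
  (x : HahnSeries ℚ K).orderTop

/-- The coefficient of `t ^ α * x ^ β` in a polynomial over the Puiseux series. -/
def termCoeff {K : Type*} [Field K] {n : ℕ} (f : MvPolynomial (Fin n) (PuiseuxSeries K))
    (α : ℚ) (β : Fin n →₀ ℕ) : K :=
  ((f.coeff β : PuiseuxSeries K) : HahnSeries ℚ K).coeff α

/-- The degree `-α + ω · β` of `t ^ α * x ^ β` with respect to the weight `(-1, ω)`. -/
def weightDeg {n : ℕ} (ω : Fin n → ℝ) (α : ℚ) (β : Fin n →₀ ℕ) : ℝ :=
  -(α : ℝ) + ∑ i, ω i * (β i : ℝ)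

/-- The `(-1, ω)`-order of `f`: the maximal degree of a term of `f` (`⊥` for `f = 0`). For a fixed
`β` the degree is maximal at the least exponent of `t` in the coefficient of `x ^ β`. -/
def weightOrder {K : Type*} [Field K] {n : ℕ} (ω : Fin n → ℝ)
    (f : MvPolynomial (Fin n) (PuiseuxSeries K)) : WithBot ℝ :=
  f.support.sup fun β =>
    (weightDeg ω ((f.coeff β : PuiseuxSeries K) : HahnSeries ℚ K).order β : WithBot ℝ)

open Classical in
/-- The `t`-initial form of `f` with respect to `ω`: the sum of the terms of `f` of maximal
`(-1, ω)`-degree, with `t` replaced by `1`. -/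
def tInitialForm {K : Type*} [Field K] {n : ℕ} (ω : Fin n → ℝ)
    (f : MvPolynomial (Fin n) (PuiseuxSeries K)) : MvPolynomial (Fin n) K :=
  ∑ β ∈ f.support,
    if (weightDeg ω ((f.coeff β : PuiseuxSeries K) : HahnSeries ℚ K).order β : WithBot ℝ)
        = weightOrder ω f
    then MvPolynomial.monomial β ((f.coeff β : PuiseuxSeries K) : HahnSeries ℚ K).leadingCoeff
    else 0

/-- Every term of `f` has degree at most the order of `f`. -/
lemma weightDeg_le_weightOrder {K : Type*} [Field K] {n : ℕ} (ω : Fin n → ℝ)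
    (f : MvPolynomial (Fin n) (PuiseuxSeries K)) {α : ℚ} {β : Fin n →₀ ℕ}
    (h : termCoeff f α β ≠ 0) : (weightDeg ω α β : WithBot ℝ) ≤ weightOrder ω f := by
  have hβ : β ∈ f.support := by
    rw [MvPolynomial.mem_support_iff]
    intro h0
    apply h
    simp [termCoeff, h0]
  refine le_trans ?_ (Finset.le_sup (f := fun β => (weightDeg ω
    ((f.coeff β : PuiseuxSeries K) : HahnSeries ℚ K).order β : WithBot ℝ)) hβ)
  rw [WithBot.coe_le_coe]
  have := HahnSeries.order_le_of_coeff_ne_zero h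
  have h2 : ((((f.coeff β : PuiseuxSeries K) : HahnSeries ℚ K).order : ℚ) : ℝ) ≤ (α : ℝ) := by
    exact_mod_cast this
  unfold weightDeg
  linarith

/-- The order of `f` is attained by a term of `f`, if `f ≠ 0`. -/
lemma exists_weightDeg_eq_weightOrder {K : Type*} [Field K] {n : ℕ} (ω : Fin n → ℝ)
    {f : MvPolynomial (Fin n) (PuiseuxSeries K)} (hf : f ≠ 0) :
    ∃ (α : ℚ) (β : Fin n →₀ ℕ),
      termCoeff f α β ≠ 0 ∧ (weightDeg ω α β : WithBot ℝ) = weightOrder ω f := by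
  obtain ⟨β, hβ, h⟩ := Finset.exists_mem_eq_sup f.support
    (MvPolynomial.support_nonempty.2 hf) (fun β => (weightDeg ω
      ((f.coeff β : PuiseuxSeries K) : HahnSeries ℚ K).order β : WithBot ℝ))
  refine ⟨_, β, ?_, h.symm⟩
  rw [MvPolynomial.mem_support_iff] at hβ
  have h0 : ((f.coeff β : PuiseuxSeries K) : HahnSeries ℚ K) ≠ 0 := by
    simpa using hβ
  exact HahnSeries.coeff_order_eq_zero.not.2 h0

/-- The coefficient of `x ^ β` in the `t`-initial form is that of the term `t ^ α * x ^ β` whose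
degree is the order of `f`. -/
lemma coeff_tInitialForm {K : Type*} [Field K] {n : ℕ} (ω : Fin n → ℝ)
    (f : MvPolynomial (Fin n) (PuiseuxSeries K)) {α : ℚ} {β : Fin n →₀ ℕ}
    (h : (weightDeg ω α β : WithBot ℝ) = weightOrder ω f) :
    (tInitialForm ω f).coeff β = termCoeff f α β := by
  classical
  have key : (tInitialForm ω f).coeff β = if β ∈ f.support then
      (if (weightDeg ω ((f.coeff β : PuiseuxSeries K) : HahnSeries ℚ K).order β : WithBot ℝ)
        = weightOrder ω f then ((f.coeff β : PuiseuxSeries K) : HahnSeries ℚ K).leadingCoeff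
        else 0) else 0 := by
    rw [tInitialForm, MvPolynomial.coeff_sum, ← Finset.sum_ite_eq' f.support β
      (fun β => if (weightDeg ω ((f.coeff β : PuiseuxSeries K) : HahnSeries ℚ K).order β :
        WithBot ℝ) = weightOrder ω f then
          ((f.coeff β : PuiseuxSeries K) : HahnSeries ℚ K).leadingCoeff else 0)]
    refine Finset.sum_congr rfl fun γ _ => ?_
    by_cases hγ : γ = β
    · subst hγ
      rw [if_pos rfl]
      split_ifs <;> simp
    · split_ifs <;> simp [hγ]
  rw [key]
  by_cases hc : termCoeff f α β = 0
  · rw [hc]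
    split_ifs with h1 h2
    · exfalso
      rw [MvPolynomial.mem_support_iff] at h1
      have h0 : ((f.coeff β : PuiseuxSeries K) : HahnSeries ℚ K) ≠ 0 := by
        simpa using h1
      rw [← h, WithBot.coe_inj] at h2
      have h3 : ((((f.coeff β : PuiseuxSeries K) : HahnSeries ℚ K).order : ℚ) : ℝ) = (α : ℝ) := by
        unfold weightDeg at h2
        linarith
      have h4 : ((f.coeff β : PuiseuxSeries K) : HahnSeries ℚ K).order = α := by exact_mod_cast h3
      apply HahnSeries.coeff_order_eq_zero.not.2 h0
      rw [h4]
      exact hc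
    · rfl
    · rfl
  · have hβ : β ∈ f.support := by
      rw [MvPolynomial.mem_support_iff]
      intro h0
      apply hc
      simp [termCoeff, h0]
    have hle := Finset.le_sup (f := fun β => (weightDeg ω
      ((f.coeff β : PuiseuxSeries K) : HahnSeries ℚ K).order β : WithBot ℝ)) hβ
    change _ ≤ weightOrder ω f at hle
    have hle2 := HahnSeries.order_le_of_coeff_ne_zero hc
    have h5 : ((((f.coeff β : PuiseuxSeries K) : HahnSeries ℚ K).order : ℚ) : ℝ) ≤ (α : ℝ) := by
      exact_mod_cast hle2
    rw [← h, WithBot.coe_le_coe] at hle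
    have h6 : ((((f.coeff β : PuiseuxSeries K) : HahnSeries ℚ K).order : ℚ) : ℝ) = (α : ℝ) := by
      unfold weightDeg at hle
      linarith
    have h4 : ((f.coeff β : PuiseuxSeries K) : HahnSeries ℚ K).order = α := by exact_mod_cast h6
    rw [if_pos hβ, h4, if_pos h, HahnSeries.leadingCoeff_eq, h4]
    rfl

/-- The `t`-initial ideal of `J` with respect to `ω`. -/
def tInitialIdeal {K : Type*} [Field K] {n : ℕ} (ω : Fin n → ℝ)
    (J : Ideal (MvPolynomial (Fin n) (PuiseuxSeries K))) : Ideal (MvPolynomial (Fin n) K) :=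
  Ideal.span (tInitialForm ω '' (J : Set (MvPolynomial (Fin n) (PuiseuxSeries K))))

/-- An ideal is monomial free if it contains no monomial `x ^ β` (`1 = x ^ 0` is a monomial). -/
def MonomialFree {K : Type*} [Field K] {n : ℕ} (I : Ideal (MvPolynomial (Fin n) K)) : Prop :=
  ∀ β : Fin n →₀ ℕ, MvPolynomial.monomial β (1 : K) ∉ I

/-- The tropical variety of `J`. -/
def tropicalVariety {K : Type*} [Field K] {n : ℕ}
    (J : Ideal (MvPolynomial (Fin n) (PuiseuxSeries K))) : Set (Fin n → ℝ) :=
  {ω | MonomialFree (tInitialIdeal ω J)}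

end TropicalLifting

end

/-!
The argument has two ingredients: the field `L` of Puiseux series is algebraically closed, and the
zeros of a zero-dimensional ideal are finitely many.

If no zero `p` of `J` had valuation vector `-ω`, then each zero `p` would have a coordinate `p i`
with `val (p i) ≠ -ω i`. One of the two terms of the linear polynomial `x i - p i`, which vanishes
at `p`, then strictly dominates the other in `(-1, ω)`-degree
(`X_sub_C_mem_dominatedSubmonoid`). Polynomials with a single dominant term are closed under
multiplication (`IsDominatedBy.mul`), so the product of these linear polynomials over the finite
zero set (`finite_zeroLocus`) and all its powers have a single dominant term. By the
Nullstellensatz some power lies in `J`, and its `t`-initial form is a nonzero multiple of a monomial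
(`IsDominatedBy.tInitialForm_eq`), so that `ω` is not in the tropical variety.

The algebraic closedness of `L` is the Newton–Puiseux theorem. A Tschirnhaus transformation removes
the second highest term of a monic polynomial of degree at least two, and rescaling the variable
by a power of `t` given by the Newton polygon makes it a polynomial over `K[[t^(1/N)]]` whose
reduction over `K` has a further nonzero term. In characteristic zero this reduction is not a power
of a linear polynomial, and a root of it of smaller multiplicity than the degree yields a
factorization, by the Weierstrass preparation theorem over the complete local ring `K[[t^(1/N)]]`
(`exists_monic_factorization_of_coeff_zero_mem`).
-/

noncomputable section

namespace TropicalLifting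

open Polynomial

/-! ### Hensel's lemma for factorizations -/

instance {K : Type*} [Field K] :
    IsAdicComplete (IsLocalRing.maximalIdeal (PowerSeries K)) (PowerSeries K) := by
  rw [PowerSeries.maximalIdeal_eq_span_X]
  infer_instance

/-- Over a complete local ring, a monic polynomial whose reduction vanishes at `0` without being a
power of the variable is reducible. The Weierstrass preparation theorem splits off the
distinguished polynomial belonging to the root `0`; by uniqueness of Weierstrass division the
cofactor, a priori a power series, is the quotient of the Euclidean division of polynomials. -/
theorem exists_monic_factorization_of_coeff_zero_mem {A : Type*} [CommRing A] [IsLocalRing A]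
    [IsAdicComplete (IsLocalRing.maximalIdeal A) A] {P : A[X]} (hP : P.Monic)
    (h0 : P.coeff 0 ∈ IsLocalRing.maximalIdeal A)
    (hi : ∃ i < P.natDegree, P.coeff i ∉ IsLocalRing.maximalIdeal A) :
    ∃ F Q : A[X], P = F * Q ∧ 0 < F.natDegree ∧ 0 < Q.natDegree := by
  have hmap : (P : PowerSeries A).map (IsLocalRing.residue A) ≠ 0 := by
    rw [← Polynomial.polynomial_map_coe]
    exact_mod_cast Polynomial.map_monic_ne_zero hP
  obtain ⟨F, h, H⟩ := PowerSeries.exists_isWeierstrassFactorization hmap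
  have hF := H.isDistinguishedAt
  have htop : IsLocalRing.maximalIdeal A ≠ ⊤ := Ideal.IsMaximal.ne_top inferInstance
  have hdeg : F.natDegree =
      ((F : PowerSeries A).map (Ideal.Quotient.mk (IsLocalRing.maximalIdeal A))).order.toNat := by
    have := hF.coe_natDegree_eq_order_map F 1
      (by rwa [map_one, ← Ideal.ne_top_iff_one]) (by simp)
    rw [← this]
    rfl
  have hdiv := (hF.isWeierstrassDivisorAt htop).eq_of_mul_add_eq_mul_add
    (q := h) (q' := ((P /ₘ F : A[X]) : PowerSeries A)) (r := 0) (r' := P %ₘ F)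
    (by rw [degree_zero]; exact WithBot.bot_lt_coe _)
    (by
      rw [← hdeg, ← Polynomial.degree_eq_natDegree hF.monic.ne_zero]
      exact Polynomial.degree_modByMonic_lt _ hF.monic)
    (by
      rw [Polynomial.coe_zero, add_zero, ← H.eq_mul, ← Polynomial.coe_mul, ← Polynomial.coe_add,
        add_comm, Polynomial.modByMonic_add_div])
  have hPF : P = F * (P /ₘ F) := by
    conv_lhs => rw [← Polynomial.modByMonic_add_div P F, ← hdiv.2, zero_add]
  have hQ : (P /ₘ F).Monic := hF.monic.of_mul_monic_left (hPF ▸ hP)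
  -- A factor of degree `0` is `1`, which makes `P` a unit power series or a distinguished polynomial.
  refine ⟨F, P /ₘ F, hPF, Nat.pos_of_ne_zero fun hF0 => ?_, Nat.pos_of_ne_zero fun hQ0 => ?_⟩
  · have hPh := H.eq_mul
    rw [hF.monic.natDegree_eq_zero.1 hF0, Polynomial.coe_one, one_mul] at hPh
    have hu := H.isUnit
    rw [← hPh, PowerSeries.isUnit_iff_constantCoeff] at hu
    rw [← PowerSeries.coeff_zero_eq_constantCoeff_apply, Polynomial.coeff_coe] at hu
    exact (IsLocalRing.mem_maximalIdeal _).1 h0 hu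
  · rw [hQ.natDegree_eq_zero.1 hQ0, mul_one] at hPF
    obtain ⟨i, hi, hiP⟩ := hi
    rw [hPF] at hi hiP
    exact hiP (hF.mem hi)

/-- The case of Hensel's lemma behind the Newton–Puiseux theorem: in characteristic zero, the
absence of the second highest term prevents the reduction from being the power of a linear
polynomial other than the variable itself. -/
theorem exists_factorization_of_nextCoeff_eq_zero {K : Type*} [Field K] [IsAlgClosed K]
    [CharZero K] {G : (PowerSeries K)[X]} (hG : G.Monic) (hnext : G.nextCoeff = 0)
    (hi : ∃ i < G.natDegree, PowerSeries.constantCoeff (G.coeff i) ≠ 0) :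
    ∃ F Q : (PowerSeries K)[X], G = F * Q ∧ 0 < F.natDegree ∧ 0 < Q.natDegree := by
  set g : K[X] := G.map PowerSeries.constantCoeff with hg
  have hgm : g.Monic := hG.map _
  have hgd : g.natDegree = G.natDegree := hG.natDegree_map _
  obtain ⟨i, hin, hi⟩ := hi
  have hmem : ∀ x : PowerSeries K, x ∈ IsLocalRing.maximalIdeal (PowerSeries K) ↔
      PowerSeries.constantCoeff x = 0 := fun x => by
    rw [PowerSeries.maximalIdeal_eq_span_X, Ideal.mem_span_singleton, PowerSeries.X_dvd_iff]
  obtain ⟨a, ha⟩ := IsAlgClosed.exists_root g (by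
    rw [Polynomial.degree_eq_natDegree hgm.ne_zero, hgd]
    exact_mod_cast (Nat.zero_le i).trans_lt hin |>.ne')
  have hmapP : (taylor (PowerSeries.C a) G).map PowerSeries.constantCoeff = taylor a g := by
    rw [Polynomial.map_taylor, PowerSeries.constantCoeff_C]
  have hcoeff : ∀ j, PowerSeries.constantCoeff ((taylor (PowerSeries.C a) G).coeff j) =
      (taylor a g).coeff j := fun j => by rw [← hmapP, Polynomial.coeff_map]
  have hPm : (taylor (PowerSeries.C a) G).Monic := by
    rw [Polynomial.Monic, Polynomial.leadingCoeff_taylor]; exact hG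
  obtain ⟨F, Q, hFQ, hF, hQ⟩ := exists_monic_factorization_of_coeff_zero_mem hPm
    (by rw [hmem, hcoeff, Polynomial.taylor_coeff_zero]; exact ha) (by
      -- Otherwise the reduction is `(X - a) ^ d`, and the absent second term forces `a = 0`.
      by_contra! hcon
      rw [Polynomial.natDegree_taylor] at hcon
      have hpow : taylor a g = X ^ G.natDegree := by
        refine (Polynomial.Monic.as_sum (p := taylor a g) ?_).trans ?_
        · rw [Polynomial.Monic, Polynomial.leadingCoeff_taylor]; exact hgm
        · rw [Polynomial.natDegree_taylor, hgd, Finset.sum_eq_zero, add_zero]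
          intro j hj
          rw [← hcoeff, (hmem _).1 (hcon j (Finset.mem_range.1 hj)), C_0, zero_mul]
      have hg2 : g = (X - C a) ^ G.natDegree := by
        apply Polynomial.taylor_injective a
        simp [hpow, Polynomial.taylor_pow]
      have hgn : g.nextCoeff = 0 := by
        rw [Polynomial.nextCoeff_of_natDegree_pos (by omega)] at hnext ⊢
        rw [hgd, hg, Polynomial.coeff_map, hnext, map_zero]
      rw [hg2, (monic_X_sub_C a).nextCoeff_pow, nextCoeff_X_sub_C, nsmul_eq_mul] at hgn
      have ha0 : a = 0 := by
        rcases mul_eq_zero.1 hgn with h | h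
        · exact absurd (Nat.cast_eq_zero.1 h) (by omega)
        · exact neg_eq_zero.1 h
      apply hi
      rw [← Polynomial.coeff_map, ← hg, hg2, ha0, C_0, sub_zero, Polynomial.coeff_X_pow,
        if_neg hin.ne])
  refine ⟨taylor (-PowerSeries.C a) F, taylor (-PowerSeries.C a) Q, ?_, ?_, ?_⟩
  · rw [← Polynomial.taylor_mul, ← hFQ, Polynomial.taylor_taylor, neg_add_cancel,
      Polynomial.taylor_zero]
  · rwa [Polynomial.natDegree_taylor]
  · rwa [Polynomial.natDegree_taylor]

/-! ### The Newton–Puiseux theorem -/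

/-- The embedding of the ring of formal power series into the field of Puiseux series that sends
the variable to `t ^ (1 / N)`. -/
def powerSeriesEmb (K : Type*) [Field K] (N : ℕ+) : PowerSeries K →+* PuiseuxSeries K :=
  ((laurentEmb K N).comp (HahnSeries.ofPowerSeries ℤ K)).codRestrict (puiseuxSubfield K)
    fun _ => ⟨N, ⟨_, rfl⟩⟩

lemma coeff_zero_powerSeriesEmb {K : Type*} [Field K] (N : ℕ+) (x : PowerSeries K) :
    (powerSeriesEmb K N x : HahnSeries ℚ K).coeff 0 = PowerSeries.constantCoeff x := by
  have h : (powerSeriesEmb K N x : HahnSeries ℚ K).coeff (expMap N 0) =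
      (HahnSeries.ofPowerSeries ℤ K x).coeff ((0 : ℕ) : ℤ) :=
    HahnSeries.embDomain_coeff (f := ⟨⟨expMap N, expMap_injective N⟩, expMap_le_iff N _ _⟩)
  rwa [map_zero, HahnSeries.ofPowerSeries_apply_coeff,
    PowerSeries.coeff_zero_eq_constantCoeff_apply] at h

lemma mem_range_powerSeriesEmb {K : Type*} [Field K] {N : ℕ+} {x : PuiseuxSeries K}
    (hx : (x : HahnSeries ℚ K) ∈ laurentSubfield K N)
    (h0 : 0 ≤ (x : HahnSeries ℚ K).orderTop) : x ∈ Set.range (powerSeriesEmb K N) := by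
  obtain ⟨y, hy⟩ := hx
  have hcoeff : ∀ m : ℤ, (x : HahnSeries ℚ K).coeff (expMap N m) = y.coeff m := fun m => by
    rw [← hy]
    exact HahnSeries.embDomain_coeff (f := ⟨⟨expMap N, expMap_injective N⟩, expMap_le_iff N _ _⟩)
  refine ⟨PowerSeries.mk fun k => y.coeff k, Subtype.ext (Eq.trans ?_ hy)⟩
  refine congrArg (laurentEmb K N) ?_
  ext m
  rcases le_or_gt 0 m with hm | hm
  · lift m to ℕ using hm
    rw [HahnSeries.ofPowerSeries_apply_coeff, PowerSeries.coeff_mk]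
  · rw [← hcoeff m, HahnSeries.coeff_eq_zero_of_lt_orderTop (x := (x : HahnSeries ℚ K)),
      HahnSeries.ofPowerSeries_apply]
    · refine HahnSeries.embDomain_of_notMem_range ?_
      rintro ⟨k, hk⟩
      have : (k : ℤ) = m := hk
      omega
    · refine lt_of_lt_of_le ?_ h0
      have : expMap N m < expMap N 0 := lt_of_le_of_ne ((expMap_le_iff N _ _).2 hm.le)
        fun h => hm.ne (expMap_injective N h)
      rw [map_zero] at this
      exact_mod_cast this

/-- The Puiseux series `t ^ q`. -/
def tPow (K : Type*) [Field K] (q : ℚ) : PuiseuxSeries K :=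
  ⟨HahnSeries.single q 1, ⟨q.den, q.den_pos⟩, mem_laurentSubfield_iff.2 fun r hr => by
    refine ⟨q.num, ?_⟩
    rw [Set.mem_singleton_iff.1 (HahnSeries.support_single_subset hr)]
    exact (Rat.num_div_den q).symm⟩

lemma tPow_mul_tPow_neg (K : Type*) [Field K] (q : ℚ) : tPow K q * tPow K (-q) = 1 := by
  apply Subtype.ext
  change HahnSeries.single q (1 : K) * HahnSeries.single (-q) 1 = 1
  rw [HahnSeries.single_mul_single, add_neg_cancel, one_mul]
  rfl

/-- Finitely many Puiseux series have a common denominator. -/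
lemma exists_forall_mem_laurentSubfield {K : Type*} [Field K] (p : (PuiseuxSeries K)[X]) :
    ∃ N : ℕ+, ∀ i, ((p.coeff i : PuiseuxSeries K) : HahnSeries ℚ K) ∈ laurentSubfield K N := by
  choose N hN using fun i => (p.coeff i).2
  refine ⟨∏ i ∈ p.support, N i, fun i => ?_⟩
  by_cases hi : i ∈ p.support
  · exact laurentSubfield_mono K (Finset.dvd_prod_of_mem N hi) (hN i)
  · rw [Polynomial.notMem_support_iff.1 hi]
    exact zero_mem _

/-- The Newton polygon step: let `s` be the least quotient of the order of the coefficient of `X ^ j`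
by `deg p - j`, over the nonzero terms of `p` below the leading one. After dividing the roots by
`t ^ s`, the coefficients are power series in some `t ^ (1 / N)` and the reduction has a term below
the leading one. -/
theorem exists_factorization_of_nextCoeff_eq_zero_puiseux {K : Type*} [Field K] [IsAlgClosed K]
    [CharZero K] {p : (PuiseuxSeries K)[X]} (hp : p.Monic) (hnext : p.nextCoeff = 0)
    (hdeg : 2 ≤ p.natDegree) :
    ∃ F Q : (PuiseuxSeries K)[X], p = F * Q ∧ 0 < F.natDegree ∧ 0 < Q.natDegree := by
  by_cases hX : p = X ^ p.natDegree
  · refine ⟨X, X ^ (p.natDegree - 1), ?_, by simp, by simp; omega⟩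
    rw [← pow_succ', Nat.sub_add_cancel (by omega)]
    exact hX
  have hne : (p.support.erase p.natDegree).Nonempty := by
    by_contra hcon
    rw [Finset.not_nonempty_iff_eq_empty] at hcon
    apply hX
    refine hp.as_sum.trans ?_
    rw [Finset.sum_eq_zero, add_zero]
    intro j hj
    have : j ∉ p.support.erase p.natDegree := by simp [hcon]
    rw [Finset.mem_erase, not_and, Polynomial.notMem_support_iff] at this
    rw [this (Finset.mem_range.1 hj).ne, C_0, zero_mul]
  obtain ⟨i, hi, hmin⟩ := Finset.exists_min_image _ (fun j =>
    ((p.coeff j : PuiseuxSeries K) : HahnSeries ℚ K).order / ((p.natDegree - j : ℕ) : ℚ)) hne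
  set s : ℚ := ((p.coeff i : PuiseuxSeries K) : HahnSeries ℚ K).order / ((p.natDegree - i : ℕ) : ℚ)
    with hs
  have hlt : ∀ j ∈ p.support.erase p.natDegree, j < p.natDegree := fun j hj =>
    lt_of_le_of_ne (Polynomial.le_natDegree_of_mem_supp _ (Finset.mem_of_mem_erase hj))
      (Finset.ne_of_mem_erase hj)
  have hcoe : ∀ j, (((p.scaleRoots (tPow K (-s))).coeff j : PuiseuxSeries K) : HahnSeries ℚ K) =
      ((p.coeff j : PuiseuxSeries K) : HahnSeries ℚ K) *
        HahnSeries.single (-((p.natDegree - j : ℕ) * s)) 1 := fun j => by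
    rw [Polynomial.coeff_scaleRoots]
    change _ * HahnSeries.single (-s) (1 : K) ^ _ = _
    rw [HahnSeries.single_pow, one_pow, nsmul_eq_mul, mul_neg]
  have horder : ∀ j, 0 ≤ (((p.scaleRoots (tPow K (-s))).coeff j : PuiseuxSeries K) :
      HahnSeries ℚ K).orderTop := by
    intro j
    by_cases hjs : j ∈ p.support
    · have hj0 : ((p.coeff j : PuiseuxSeries K) : HahnSeries ℚ K) ≠ 0 := by
        simpa using hjs
      have hle : (p.natDegree - j : ℕ) * s ≤
          ((p.coeff j : PuiseuxSeries K) : HahnSeries ℚ K).order := by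
        by_cases hjn : j = p.natDegree
        · subst hjn
          rw [Polynomial.coeff_natDegree, hp.leadingCoeff]
          simp
        · have hmem := Finset.mem_erase.2 ⟨hjn, hjs⟩
          have hpos : (0 : ℚ) < (p.natDegree - j : ℕ) := by
            exact_mod_cast Nat.sub_pos_of_lt (hlt j hmem)
          rw [mul_comm, ← le_div_iff₀ hpos]
          exact hmin j hmem
      rw [hcoe, HahnSeries.orderTop_mul, HahnSeries.orderTop_single one_ne_zero,
        ← HahnSeries.order_eq_orderTop_of_ne_zero hj0, ← WithTop.coe_add]
      exact_mod_cast (by linarith : (0 : ℚ) ≤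
        ((p.coeff j : PuiseuxSeries K) : HahnSeries ℚ K).order + -((p.natDegree - j : ℕ) * s))
    · rw [hcoe, Polynomial.notMem_support_iff.1 hjs]
      simp
  have hcoeffi : (((p.scaleRoots (tPow K (-s))).coeff i : PuiseuxSeries K) :
      HahnSeries ℚ K).coeff 0 ≠ 0 := by
    have hi0 : ((p.coeff i : PuiseuxSeries K) : HahnSeries ℚ K) ≠ 0 := by
      simpa using Finset.mem_of_mem_erase hi
    have hpos : ((p.natDegree - i : ℕ) : ℚ) ≠ 0 := by
      exact_mod_cast (Nat.sub_pos_of_lt (hlt i hi)).ne'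
    have h1 : (p.natDegree - i : ℕ) * s =
        ((p.coeff i : PuiseuxSeries K) : HahnSeries ℚ K).order := by
      rw [hs, mul_div_cancel₀ _ hpos]
    have h2 := HahnSeries.coeff_mul_single_add (r := (1 : K))
      (x := ((p.coeff i : PuiseuxSeries K) : HahnSeries ℚ K))
      (a := ((p.coeff i : PuiseuxSeries K) : HahnSeries ℚ K).order)
      (b := -((p.natDegree - i : ℕ) * s))
    rw [← hcoe, h1, add_neg_cancel, mul_one] at h2
    rw [h2]
    exact HahnSeries.coeff_order_eq_zero.not.2 hi0
  -- The rescaled polynomial descends to a monic `G` over the power series in `t ^ (1 / N)`.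
  obtain ⟨N, hN⟩ := exists_forall_mem_laurentSubfield (p.scaleRoots (tPow K (-s)))
  obtain ⟨G, hGp, hGd, hGm⟩ := Polynomial.lifts_and_natDegree_eq_and_monic
    ((Polynomial.lifts_iff_coeff_lifts _).2 fun j => mem_range_powerSeriesEmb (hN j) (horder j))
    ((Polynomial.monic_scaleRoots_iff _).2 hp)
  have hinj : Function.Injective (powerSeriesEmb K N) := fun x y h =>
    HahnSeries.ofPowerSeries_injective (Γ := ℤ) ((laurentEmb K N).injective
      (congrArg Subtype.val h))
  rw [Polynomial.natDegree_scaleRoots] at hGd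
  obtain ⟨F, Q, hFQ, hF, hQ⟩ := exists_factorization_of_nextCoeff_eq_zero hGm (by
      rw [Polynomial.nextCoeff_of_natDegree_pos (by omega)] at hnext ⊢
      apply hinj
      rw [← Polynomial.coeff_map, hGp, Polynomial.coeff_scaleRoots, hGd, hnext, zero_mul, map_zero])
    ⟨i, hGd ▸ hlt i hi, by
      rwa [← coeff_zero_powerSeriesEmb N, ← Polynomial.coeff_map, hGp]⟩
  refine ⟨(F.map (powerSeriesEmb K N)).scaleRoots (tPow K s),
    (Q.map (powerSeriesEmb K N)).scaleRoots (tPow K s), ?_, ?_, ?_⟩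
  · rw [← Polynomial.mul_scaleRoots_of_noZeroDivisors, ← Polynomial.map_mul, ← hFQ, hGp,
      ← Polynomial.scaleRoots_mul, mul_comm, tPow_mul_tPow_neg, Polynomial.scaleRoots_one]
  · rwa [Polynomial.natDegree_scaleRoots, Polynomial.natDegree_map_eq_of_injective hinj]
  · rwa [Polynomial.natDegree_scaleRoots, Polynomial.natDegree_map_eq_of_injective hinj]

/-- The Tschirnhaus transformation: translating the roots so that their sum becomes zero removes
the second highest term. -/
lemma nextCoeff_taylor_eq_zero {L : Type*} [Field L] [CharZero L] {p : L[X]} (hp : p.Monic)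
    (hdeg : 0 < p.natDegree) : (taylor (-(p.nextCoeff / p.natDegree)) p).nextCoeff = 0 := by
  have hn : (p.natDegree : L) ≠ 0 := Nat.cast_ne_zero.2 hdeg.ne'
  rw [Polynomial.nextCoeff_of_natDegree_pos (by rwa [Polynomial.natDegree_taylor]),
    Polynomial.natDegree_taylor, Polynomial.taylor_coeff,
    Polynomial.eval_eq_sum_range' (n := 2)
      ((Polynomial.natDegree_hasseDeriv_le _ _).trans_lt (by omega)),
    Finset.sum_range_succ, Finset.sum_range_one, Polynomial.hasseDeriv_coeff,
    Polynomial.hasseDeriv_coeff, zero_add, Nat.choose_self,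
    ← Polynomial.nextCoeff_of_natDegree_pos hdeg, show 1 + (p.natDegree - 1) = p.natDegree by omega,
    Polynomial.coeff_natDegree, hp.leadingCoeff]
  have hc : p.natDegree.choose (p.natDegree - 1) = p.natDegree := by
    rw [Nat.choose_symm (by omega), Nat.choose_one_right]
  rw [hc]
  field_simp
  simp

/-- The **Newton–Puiseux theorem**. -/
instance {K : Type*} [Field K] [IsAlgClosed K] [CharZero K] : IsAlgClosed (PuiseuxSeries K) := by
  have : CharZero (PuiseuxSeries K) :=
    charZero_of_injective_ringHom ((powerSeriesEmb K 1).comp PowerSeries.C).injective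
  refine IsAlgClosed.of_exists_root _ fun p hp hirr => ?_
  by_cases hdeg : 2 ≤ p.natDegree
  · exfalso
    set c := -(p.nextCoeff / p.natDegree)
    obtain ⟨F, Q, hFQ, hF, hQ⟩ := exists_factorization_of_nextCoeff_eq_zero_puiseux
      (p := taylor c p) (by rw [Polynomial.Monic, Polynomial.leadingCoeff_taylor]; exact hp)
      (nextCoeff_taylor_eq_zero hp (by omega)) (by rwa [Polynomial.natDegree_taylor])
    have hirr' : Irreducible (taylor c p) :=
      (MulEquiv.irreducible_iff (taylorEquiv c)).2 hirr
    rcases hirr'.isUnit_or_isUnit hFQ with h | h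
    · exact hF.ne' (Polynomial.natDegree_eq_zero_of_isUnit h)
    · exact hQ.ne' (Polynomial.natDegree_eq_zero_of_isUnit h)
  · have h1 : p.degree = 1 := by
      rw [Polynomial.degree_eq_natDegree hp.ne_zero]
      have := hirr.natDegree_pos
      exact_mod_cast (by omega : p.natDegree = 1)
    exact Polynomial.exists_root_of_degree_eq_one h1

/-! ### Polynomials with a single term of maximal weight -/

/-- The pairing `ω · β` for rational weights. -/
def dotWeight {n : ℕ} (ω : Fin n → ℚ) (β : Fin n →₀ ℕ) : ℚ := ∑ i, ω i * (β i : ℚ)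

lemma dotWeight_add {n : ℕ} (ω : Fin n → ℚ) (β γ : Fin n →₀ ℕ) :
    dotWeight ω (β + γ) = dotWeight ω β + dotWeight ω γ := by
  simp [dotWeight, mul_add, Finset.sum_add_distrib]

lemma dotWeight_single {n : ℕ} (ω : Fin n → ℚ) (i : Fin n) :
    dotWeight ω (Finsupp.single i 1) = ω i := by
  rw [dotWeight, Finset.sum_eq_single i]
  · simp
  · intro j _ hj
    simp [Finsupp.single_eq_of_ne hj]
  · simp

/-- The valuation of the field of Puiseux series. -/
def puiseuxVal (K : Type*) [Field K] : AddValuation (PuiseuxSeries K) (WithTop ℚ) :=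
  (HahnSeries.addVal ℚ K).comap (puiseuxSubfield K).subtype

lemma puiseuxVal_apply {K : Type*} [Field K] (x : PuiseuxSeries K) : puiseuxVal K x = val x :=
  HahnSeries.addVal_apply

/-- The term of `f` at `x ^ β` has `(-1, ω)`-degree `-d`, and all other terms have smaller
degree. Vanishing coefficients have valuation `⊤` and satisfy the inequality. -/
structure IsDominatedBy {K : Type*} [Field K] {n : ℕ} (ω : Fin n → ℚ)
    (f : MvPolynomial (Fin n) (PuiseuxSeries K)) (β : Fin n →₀ ℕ) (d : ℚ) : Prop where
  val_eq : puiseuxVal K (f.coeff β) = ((d + dotWeight ω β : ℚ) : WithTop ℚ)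
  lt_val : ∀ γ, γ ≠ β → ((d + dotWeight ω γ : ℚ) : WithTop ℚ) < puiseuxVal K (f.coeff γ)

namespace IsDominatedBy

variable {K : Type*} [Field K] {n : ℕ} {ω : Fin n → ℚ}

lemma le_val {f : MvPolynomial (Fin n) (PuiseuxSeries K)} {β : Fin n →₀ ℕ} {d : ℚ}
    (hf : IsDominatedBy ω f β d) (γ : Fin n →₀ ℕ) :
    ((d + dotWeight ω γ : ℚ) : WithTop ℚ) ≤ puiseuxVal K (f.coeff γ) := by
  by_cases h : γ = β
  · rw [h, hf.val_eq]
  · exact (hf.lt_val γ h).le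

lemma one : IsDominatedBy ω (1 : MvPolynomial (Fin n) (PuiseuxSeries K)) 0 0 where
  val_eq := by
    rw [MvPolynomial.coeff_zero_one, AddValuation.map_one]
    simp [dotWeight]
  lt_val γ hγ := by
    rw [MvPolynomial.coeff_one, if_neg hγ.symm, AddValuation.map_zero]
    exact WithTop.coe_lt_top _

/-- A product of two terms that are not both dominant has valuation above the bound. -/
lemma lt_val_mul {f g : MvPolynomial (Fin n) (PuiseuxSeries K)} {β γ : Fin n →₀ ℕ} {d e : ℚ}
    (hf : IsDominatedBy ω f β d) (hg : IsDominatedBy ω g γ e) {β' γ' : Fin n →₀ ℕ}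
    (h : (β', γ') ≠ (β, γ)) : ((d + e + dotWeight ω (β' + γ') : ℚ) : WithTop ℚ) <
      puiseuxVal K (f.coeff β' * g.coeff γ') := by
  have hsum : ((d + e + dotWeight ω (β' + γ') : ℚ) : WithTop ℚ) =
      ((d + dotWeight ω β' : ℚ) : WithTop ℚ) + ((e + dotWeight ω γ' : ℚ) : WithTop ℚ) := by
    rw [dotWeight_add, ← WithTop.coe_add]
    congr 1
    ring
  rw [hsum, AddValuation.map_mul]
  by_cases hβ : β' = β
  · have hγ : γ' ≠ γ := fun hγ => h (by rw [hβ, hγ])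
    exact WithTop.add_lt_add_of_le_of_lt WithTop.coe_ne_top (hf.le_val _) (hg.lt_val _ hγ)
  · exact WithTop.add_lt_add_of_lt_of_le WithTop.coe_ne_top (hf.lt_val _ hβ) (hg.le_val _)

lemma mul {f g : MvPolynomial (Fin n) (PuiseuxSeries K)} {β γ : Fin n →₀ ℕ} {d e : ℚ}
    (hf : IsDominatedBy ω f β d) (hg : IsDominatedBy ω g γ e) :
    IsDominatedBy ω (f * g) (β + γ) (d + e) where
  val_eq := by
    classical
    have hmem : (β, γ) ∈ Finset.HasAntidiagonal.antidiagonal (β + γ) := by simp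
    have hval : puiseuxVal K (f.coeff β * g.coeff γ) =
        ((d + e + dotWeight ω (β + γ) : ℚ) : WithTop ℚ) := by
      rw [AddValuation.map_mul, hf.val_eq, hg.val_eq, dotWeight_add, ← WithTop.coe_add]
      congr 1
      ring
    rw [MvPolynomial.coeff_mul, ← Finset.add_sum_erase _ _ hmem,
      AddValuation.map_add_eq_of_lt_left, hval]
    rw [hval]
    refine AddValuation.map_lt_sum _ WithTop.coe_ne_top fun x hx => ?_
    rw [Finset.mem_erase, Finset.HasAntidiagonal.mem_antidiagonal] at hx
    rw [← hx.2]
    exact hf.lt_val_mul hg hx.1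
  lt_val δ hδ := by
    classical
    rw [MvPolynomial.coeff_mul]
    refine AddValuation.map_lt_sum _ WithTop.coe_ne_top fun x hx => ?_
    rw [Finset.HasAntidiagonal.mem_antidiagonal] at hx
    rw [← hx]
    refine hf.lt_val_mul hg fun h => hδ ?_
    rw [← hx, congrArg Prod.fst h, congrArg Prod.snd h]

/-- The `t`-initial form of a polynomial with a single dominant term is a nonzero multiple of a
monomial. -/
lemma tInitialForm_eq {f : MvPolynomial (Fin n) (PuiseuxSeries K)} {β : Fin n →₀ ℕ} {d : ℚ}
    (hf : IsDominatedBy ω f β d) :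
    ∃ c : K, c ≠ 0 ∧ tInitialForm (fun i => (ω i : ℝ)) f = MvPolynomial.monomial β c := by
  classical
  have hvo : ∀ γ ∈ f.support, puiseuxVal K (f.coeff γ) =
      ((((f.coeff γ : PuiseuxSeries K) : HahnSeries ℚ K).order : ℚ) : WithTop ℚ) := by
    intro γ hγ
    have h0 : ((f.coeff γ : PuiseuxSeries K) : HahnSeries ℚ K) ≠ 0 := by simpa using hγ
    rw [puiseuxVal_apply, val, HahnSeries.order_eq_orderTop_of_ne_zero h0]
  have hβ : β ∈ f.support := by
    rw [MvPolynomial.mem_support_iff]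
    intro h0
    have := hf.val_eq
    rw [h0, AddValuation.map_zero] at this
    exact WithTop.top_ne_coe this
  have hβ0 : ((f.coeff β : PuiseuxSeries K) : HahnSeries ℚ K) ≠ 0 := by simpa using hβ
  have hdeg : ∀ (q : ℚ) (γ : Fin n →₀ ℕ),
      weightDeg (fun i => (ω i : ℝ)) q γ = ((-q + dotWeight ω γ : ℚ) : ℝ) := by
    intro q γ
    simp [weightDeg, dotWeight]
  have hdβ : weightDeg (fun i => (ω i : ℝ))
      ((f.coeff β : PuiseuxSeries K) : HahnSeries ℚ K).order β = ((-d : ℚ) : ℝ) := by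
    have := hf.val_eq
    rw [hvo β hβ, WithTop.coe_eq_coe] at this
    rw [hdeg, this]
    congr 1
    ring
  have hdγ : ∀ γ ∈ f.support, γ ≠ β → weightDeg (fun i => (ω i : ℝ))
      ((f.coeff γ : PuiseuxSeries K) : HahnSeries ℚ K).order γ < ((-d : ℚ) : ℝ) := by
    intro γ hγ hne
    have := hf.lt_val γ hne
    rw [hvo γ hγ, WithTop.coe_lt_coe] at this
    rw [hdeg, Rat.cast_lt]
    linarith
  have hord : weightOrder (fun i => (ω i : ℝ)) f = (((-d : ℚ) : ℝ) : WithBot ℝ) := by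
    refine le_antisymm (Finset.sup_le fun γ hγ => ?_) ?_
    · rw [WithBot.coe_le_coe]
      by_cases hne : γ = β
      · rw [hne, hdβ]
      · exact (hdγ γ hγ hne).le
    · rw [← hdβ]
      exact Finset.le_sup (f := fun γ => (weightDeg (fun i => (ω i : ℝ))
        ((f.coeff γ : PuiseuxSeries K) : HahnSeries ℚ K).order γ : WithBot ℝ)) hβ
  refine ⟨((f.coeff β : PuiseuxSeries K) : HahnSeries ℚ K).leadingCoeff,
    HahnSeries.leadingCoeff_ne_zero.2 hβ0, ?_⟩
  rw [tInitialForm, Finset.sum_eq_single_of_mem β hβ, if_pos (by rw [hord, hdβ])]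
  intro γ hγ hne
  rw [if_neg]
  rw [hord, WithBot.coe_inj]
  exact (hdγ γ hγ hne).ne

end IsDominatedBy

/-- The polynomials with a unique term of maximal `(-1, ω)`-degree, as a multiplicative set. -/
def dominatedSubmonoid (K : Type*) [Field K] {n : ℕ} (ω : Fin n → ℚ) :
    Submonoid (MvPolynomial (Fin n) (PuiseuxSeries K)) where
  carrier := {f | ∃ β d, IsDominatedBy ω f β d}
  one_mem' := ⟨0, 0, IsDominatedBy.one⟩
  mul_mem' := by
    rintro f g ⟨β, d, hf⟩ ⟨γ, e, hg⟩
    exact ⟨_, _, hf.mul hg⟩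

/-- If `val a ≠ -ω i`, then one of the two terms of `x i - a` dominates the other. -/
lemma X_sub_C_mem_dominatedSubmonoid {K : Type*} [Field K] {n : ℕ} {ω : Fin n → ℚ} {i : Fin n}
    {a : PuiseuxSeries K} (ha : val a ≠ ((-ω i : ℚ) : WithTop ℚ)) :
    MvPolynomial.X i - MvPolynomial.C a ∈ dominatedSubmonoid K ω := by
  classical
  have h0 : (MvPolynomial.X i - MvPolynomial.C a : MvPolynomial (Fin n) (PuiseuxSeries K)).coeff 0 =
      -a := by simp
  have hne : (Finsupp.single i 1 : Fin n →₀ ℕ) ≠ 0 := by simp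
  have h1 : (MvPolynomial.X i - MvPolynomial.C a : MvPolynomial (Fin n) (PuiseuxSeries K)).coeff
      (Finsupp.single i 1) = 1 := by
    simp [MvPolynomial.coeff_C, hne.symm]
  have hγ : ∀ γ : Fin n →₀ ℕ, γ ≠ 0 → γ ≠ Finsupp.single i 1 →
      (MvPolynomial.X i - MvPolynomial.C a : MvPolynomial (Fin n) (PuiseuxSeries K)).coeff γ =
        0 := by
    intro γ h h'
    rw [MvPolynomial.coeff_sub, MvPolynomial.coeff_X, MvPolynomial.coeff_C, if_neg h'.symm,
      if_neg h.symm, sub_zero]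
  have hw0 : dotWeight ω 0 = 0 := by simp [dotWeight]
  rw [← puiseuxVal_apply] at ha
  -- The constant term dominates if `val a < -ω i`, and `x i` dominates if `val a > -ω i`.
  rcases lt_or_gt_of_ne ha with h | h
  · obtain ⟨q, hq⟩ := WithTop.ne_top_iff_exists.1 h.ne_top
    rw [← hq, WithTop.coe_lt_coe] at h
    refine ⟨0, q, ?_, fun γ hγ0 => ?_⟩
    · rw [h0, AddValuation.map_neg, ← hq, hw0, add_zero]
    · by_cases hγ1 : γ = Finsupp.single i 1
      · rw [hγ1, h1, AddValuation.map_one, dotWeight_single]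
        exact_mod_cast (by linarith : q + ω i < 0)
      · rw [hγ γ hγ0 hγ1, AddValuation.map_zero]
        exact WithTop.coe_lt_top _
  · refine ⟨Finsupp.single i 1, -ω i, ?_, fun γ hγ1 => ?_⟩
    · rw [h1, AddValuation.map_one, dotWeight_single, neg_add_cancel]
      rfl
    · by_cases hγ0 : γ = 0
      · rw [hγ0, h0, AddValuation.map_neg, hw0, add_zero]
        exact h
      · rw [hγ γ hγ0 hγ1, AddValuation.map_zero]
        exact WithTop.coe_lt_top _

/-! ### The lifting lemma -/

/-- A zero-dimensional ideal has finitely many zeros: they correspond to prime ideals of the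
Artinian ring of coordinates. -/
lemma finite_zeroLocus {k : Type*} [Field k] {σ : Type*} [Finite σ]
    (J : Ideal (MvPolynomial σ k)) (hJ : ringKrullDim (MvPolynomial σ k ⧸ J) = 0) :
    (MvPolynomial.zeroLocus k J).Finite := by
  have : Ring.KrullDimLE 0 (MvPolynomial σ k ⧸ J) := by
    rw [Ring.krullDimLE_iff, hJ]
    rfl
  have : IsArtinianRing (MvPolynomial σ k ⧸ J) :=
    isArtinianRing_iff_krullDimLE_zero.2 inferInstance
  let φ : ∀ p : MvPolynomial.zeroLocus k J, (MvPolynomial σ k ⧸ J) →ₐ[k] k := fun p =>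
    Ideal.Quotient.liftₐ J (MvPolynomial.aeval p.1) fun f hf => p.2 f hf
  have hX : ∀ (p q : MvPolynomial.zeroLocus k J) (i : σ),
      φ q (Ideal.Quotient.mk J (MvPolynomial.X i - MvPolynomial.C (p.1 i))) = q.1 i - p.1 i := by
    intro p q i
    change MvPolynomial.aeval q.1 _ = _
    simp
  refine Finite.of_injective (β := PrimeSpectrum (MvPolynomial σ k ⧸ J))
    (fun p => ⟨RingHom.ker (φ p), RingHom.ker_isPrime _⟩) fun p q hpq => ?_
  have hker : RingHom.ker (φ p) = RingHom.ker (φ q) := congrArg PrimeSpectrum.asIdeal hpq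
  refine Subtype.ext (funext fun i => ?_)
  have hmem : Ideal.Quotient.mk J (MvPolynomial.X i - MvPolynomial.C (p.1 i)) ∈
      RingHom.ker (φ p) := by
    rw [RingHom.mem_ker, hX, sub_self]
  rw [hker, RingHom.mem_ker, hX] at hmem
  exact (sub_eq_zero.1 hmem).symm

end TropicalLifting

open TropicalLifting in
/-- If `K` is algebraically closed of characteristic zero and `J` is a zero-dimensional ideal of
`K{{t}}[x_1, …, x_n]`, then every rational point `ω` of the tropical variety of `J` lifts to a
zero `p` of `J` with `-val p = ω`. -/
theorem theorem3p1 {K : Type*} [Field K] [IsAlgClosed K] [CharZero K] {n : ℕ}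
    (J : Ideal (MvPolynomial (Fin n) (TropicalLifting.PuiseuxSeries K)))
    (hJ : ringKrullDim (MvPolynomial (Fin n) (TropicalLifting.PuiseuxSeries K) ⧸ J) = 0)
    (ω : Fin n → ℚ)
    (hω : (fun i => (ω i : ℝ)) ∈ TropicalLifting.tropicalVariety J) :
    ∃ p ∈ MvPolynomial.zeroLocus (TropicalLifting.PuiseuxSeries K) J,
      ∀ i, TropicalLifting.val (p i) = ((-ω i : ℚ) : WithTop ℚ) := by
  by_contra! hcon
  obtain ⟨s, hs⟩ := (finite_zeroLocus J hJ).exists_finset_coe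
  have hex : ∀ p ∈ MvPolynomial.zeroLocus (PuiseuxSeries K) J,
      ∃ g ∈ dominatedSubmonoid K ω, MvPolynomial.aeval p g = 0 := fun p hp => by
    obtain ⟨i, hi⟩ := hcon p hp
    exact ⟨_, X_sub_C_mem_dominatedSubmonoid hi, by simp⟩
  choose! g hgdom hgp using hex
  have hrad : ∏ p ∈ s, g p ∈ J.radical := by
    rw [← MvPolynomial.vanishingIdeal_zeroLocus_eq_radical (K := PuiseuxSeries K),
      MvPolynomial.mem_vanishingIdeal_iff]
    intro p hp
    rw [map_prod]
    exact Finset.prod_eq_zero (by rwa [← hs, Finset.mem_coe] at hp) (hgp p hp)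
  obtain ⟨m, hm⟩ := hrad
  obtain ⟨β, d, hdom⟩ := (dominatedSubmonoid K ω).pow_mem ((dominatedSubmonoid K ω).prod_mem
    fun p hp => hgdom p (by rwa [← hs, Finset.mem_coe])) m
  obtain ⟨c, hc, hin⟩ := hdom.tInitialForm_eq
  refine hω β ?_
  have hmem : MvPolynomial.monomial β c ∈ tInitialIdeal (fun i => (ω i : ℝ)) J :=
    Ideal.subset_span ⟨_, hm, hin⟩
  have := (tInitialIdeal (fun i => (ω i : ℝ)) J).mul_mem_left (MvPolynomial.C c⁻¹) hmem
  rwa [MvPolynomial.C_mul_monomial, inv_mul_cancel₀ hc] at this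
end
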